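/- Let $\mathbb{F}$ be $\mathbb{R}$ or $\mathbb{C}$. Then there is a Banach space $\mathbb{X}$ over $\mathbb{F}$ with a Schauder basis $(x_n)_{n=1}^\infty$ that is $1$-almost greedy but is not $C$-greedy for any constant $C\ge 1$. Here, for $x=\sum_{n} a_n x_n\in\mathbb{X}$ and a finite set $A\subset\mathbb{N}$, write $S_A(x)=\sum_{n\in A}a_n x_n$, and call $A$ a greedy set of $x$ if $|a_n|\ge |a_k|$ for all $n\in A$ and $k\in\mathbb{N}\setminus A$. The basis is called $C$-greedy if \[ \|x-S_A(x)\|\le C\,\inf\Big\{\Big\|x-\sum_{n\in B}c_n x_n\Big\| : B\subset\mathbb{N},\ |B|\le m,\ (c_n)_{n\in B}\in\mathbb{F}^B\Big\} \] for all $x\in\mathbb{X}$, all integers $m\ge 0$ and all greedy sets $A$ of $x$ with $|A|=m$; it is called $C$-almost greedy if \[ \|x-S_A(x)\|\le C\,\inf\big\{\|x-S_B(x)\| : B\subset\mathbb{N},\ |B|\le m\big\} \] for the same $x$, $m$ and $A$. -/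

import Mathlib

universe u

namespace TGA

noncomputable section

variable {𝕜 : Type*} [RCLike 𝕜] {X : Type*} [NormedAddCommGroup X] [NormedSpace 𝕜 X]

/-- The coordinate projection `S_A(x) = ∑ n ∈ A, a_n x_n` of `x = ∑ a_n x_n` onto the span of
the basis vectors indexed by the finite set `A`. -/
def coordProj (b : SchauderBasis 𝕜 X) (A : Finset ℕ) (x : X) : X :=
  ∑ n ∈ A, b.coord n x • b n

/-- `A` is a greedy set of `x`: every coefficient of `x` indexed by `A` is at least as large in
modulus as every coefficient outside `A`. The `m`-term greedy approximations of `x` are the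
vectors `S_A(x)`, where `A` runs over the greedy sets of `x` with exactly `m` elements. -/
def IsGreedySet (b : SchauderBasis 𝕜 X) (x : X) (A : Finset ℕ) : Prop :=
  ∀ n ∈ A, ∀ k ∉ A, ‖b.coord k x‖ ≤ ‖b.coord n x‖

/-- The error `σ_m(x)` of the best nonlinear `m`-term approximation to `x`: the infimum of
`‖x - y‖` over all linear combinations `y` of at most `m` basis vectors. -/
def bestError (b : SchauderBasis 𝕜 X) (m : ℕ) (x : X) : ℝ :=
  sInf {r : ℝ | ∃ (A : Finset ℕ) (c : ℕ → 𝕜), A.card ≤ m ∧ r = ‖x - ∑ n ∈ A, c n • b n‖}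

/-- The error of the best `m`-term approximation to `x` by coordinate projections: the infimum of
`‖x - S_A(x)‖` over all sets `A` with at most `m` elements. -/
def bestProjError (b : SchauderBasis 𝕜 X) (m : ℕ) (x : X) : ℝ :=
  sInf {r : ℝ | ∃ A : Finset ℕ, A.card ≤ m ∧ r = ‖x - coordProj b A x‖}

/-- `C`-greedy bases: `‖x - G_m(x)‖ ≤ C σ_m(x)` for all `x`, all `m`, and all `m`-term greedy
approximations `G_m(x)` of `x`. -/
def IsGreedyBasis (C : ℝ) (b : SchauderBasis 𝕜 X) : Prop :=
  ∀ (x : X) (m : ℕ) (A : Finset ℕ), A.card = m → IsGreedySet b x A →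
    ‖x - coordProj b A x‖ ≤ C * bestError b m x

/-- `C`-almost greedy bases: `‖x - G_m(x)‖ ≤ C inf {‖x - S_B(x)‖ : |B| ≤ m}` for all `x`, all `m`,
and all `m`-term greedy approximations `G_m(x)` of `x`. -/
def IsAlmostGreedyBasis (C : ℝ) (b : SchauderBasis 𝕜 X) : Prop :=
  ∀ (x : X) (m : ℕ) (A : Finset ℕ), A.card = m → IsGreedySet b x A →
    ‖x - coordProj b A x‖ ≤ C * bestProjError b m x

end

end TGA

/-! The norm is the supremum of `‖pair g x‖` over the functionals `fn m A N ε`. Each has a free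
part, with coefficients of modulus at most 1/√m on a set A of at most m places, and a rigid part
with positive coefficients min(1/√m, 1/√(n+1))/4 at the places n < N off A. The free part follows
large coefficients wherever they sit, which gives almost greediness; the rigid part has fixed signs,
which destroys unconditionality.

Almost greediness with constant 1 reduces to one move: deleting a largest coefficient b, or
replacing it by a smaller one at another place, must not increase the norm
(`isAlmostGreedyBasis_one_of_move`). Given a functional tested on the vector without b, put the
place of b into A and replace m by m + 1. By `wt_step` the new term exceeds the loss by at least
|b|/(4√m), which is the most that a smaller coefficient off A can contribute
(`exists_mem_fnSet_gain`).

The basis is conditional: the vectors with coefficients (-1)^n/√(n+1), n < M, are bounded in norm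
(`norm_pair_alternating_le`), while their even parts see the harmonic series
(`sum_le_norm_pair_even`). Enlarging the odd coefficients makes the odd places a greedy set. The
greedy remainder is then the even part, but other coefficients at the same places leave the
alternating vector. -/

namespace TGA

/-! ### Schauder bases from norming sets of functionals -/

/-- The value at the sequence `u` of the functional with finitely many nonzero coefficients `g`. -/
def pair {𝕜 : Type*} [RCLike 𝕜] (g : ℕ →₀ 𝕜) (u : ℕ → 𝕜) : 𝕜 := ∑ n ∈ g.support, g n * u n

section Pair

variable {𝕜 : Type*} [RCLike 𝕜]

lemma pair_eq_sum (g : ℕ →₀ 𝕜) (u : ℕ → 𝕜) {T : Finset ℕ} (h : g.support ⊆ T) :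
    pair g u = ∑ n ∈ T, g n * u n := by
  refine Finset.sum_subset h fun n _ hn => ?_
  simp [Finsupp.notMem_support_iff.1 hn]

lemma pair_congr {g g' : ℕ →₀ 𝕜} {u v : ℕ → 𝕜} (h : ∀ n, g n * u n = g' n * v n) :
    pair g u = pair g' v := by
  rw [pair_eq_sum g u (Finset.subset_union_left (s₂ := g'.support)),
    pair_eq_sum g' v (Finset.subset_union_right (s₁ := g.support))]
  exact Finset.sum_congr rfl fun n _ => h n

lemma pair_add_single (g : ℕ →₀ 𝕜) (u : ℕ → 𝕜) (k : ℕ) (b : 𝕜) :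
    pair g (u + Pi.single k b) = pair g u + g k * b := by
  have h : g.support ⊆ insert k g.support := Finset.subset_insert _ _
  rw [pair_eq_sum g _ h, pair_eq_sum g _ h]
  simp [mul_add, Finset.sum_add_distrib, Pi.single_apply]

end Pair

/-- If the closed span of a sequence is normed by a set of finitely supported functionals that
contains the coordinate functionals and is stable under truncation to initial segments, then the
sequence is a Schauder basis of its closed span. -/
theorem exists_schauderBasis_of_functionals {𝕜 : Type u} [RCLike 𝕜] {F : Set (ℕ →₀ 𝕜)}
    (hcoord : ∀ n, Finsupp.single n 1 ∈ F) (htrunc : ∀ g ∈ F, ∀ M, g.filter (· < M) ∈ F)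
    {E : Type u} [NormedAddCommGroup E] [NormedSpace 𝕜 E] [CompleteSpace E] (e : ℕ → E)
    (ev : F → E →L[𝕜] 𝕜) (he : ∀ g n, ev g (e n) = g.1 n)
    (hnorm : ∀ x r, ‖x‖ ≤ r ↔ ∀ g, ‖ev g x‖ ≤ r) :
    ∃ (X : Type u) (_ : NormedAddCommGroup X) (_ : NormedSpace 𝕜 X) (_ : CompleteSpace X)
      (b : SchauderBasis 𝕜 X), ∀ (x : X) (r : ℝ),
        ‖x‖ ≤ r ↔ ∀ g ∈ F, ‖pair g (fun n => b.coord n x)‖ ≤ r := by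
  classical
  let c : ℕ → E →L[𝕜] 𝕜 := fun n => ev ⟨Finsupp.single n 1, hcoord n⟩
  have hce : ∀ i j, c i (e j) = if i = j then 1 else 0 := by
    intro i j
    simp only [c, he, Finsupp.single_apply]
  let S : Submodule 𝕜 E := Submodule.span 𝕜 (Set.range e)
  let X : Submodule 𝕜 E := S.topologicalClosure
  have hSX : S ≤ X := S.le_topologicalClosure
  have heX : ∀ n, e n ∈ X := fun n => hSX (Submodule.subset_span ⟨n, rfl⟩)
  -- Both sides are continuous in x and agree on every `e n`, hence on the closed span.
  have hval : ∀ x ∈ X, ∀ g : F, ev g x = pair g.1 (fun n => c n x) := by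
    intro x hx g
    let L : E →L[𝕜] 𝕜 := ev g - ∑ n ∈ g.1.support, g.1 n • c n
    have hL : X ≤ LinearMap.ker (L : E →ₗ[𝕜] 𝕜) := by
      refine Submodule.topologicalClosure_minimal _ ?_ L.isClosed_ker
      refine Submodule.span_le.2 ?_
      rintro _ ⟨n, rfl⟩
      have : L (e n) = 0 := by
        simp [L, he, hce, sub_eq_zero]
      exact this
    have : L x = 0 := hL hx
    simp only [L, _root_.sub_apply, _root_.sum_apply, sub_eq_zero,
      _root_.smul_apply, smul_eq_mul] at this
    exact this
  let P : ℕ → E →L[𝕜] E := fun M => ∑ n ∈ Finset.range M, (c n).smulRight (e n)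
  have hP : ∀ M x, P M x = ∑ n ∈ Finset.range M, c n x • e n := by
    intro M x
    simp [P]
  -- A functional applied to a partial sum is its truncation applied to x, so partial sums are
  -- contractions on X. With `hPS` this gives convergence by density.
  have hPX : ∀ M, ∀ x ∈ X, ‖P M x‖ ≤ ‖x‖ := by
    intro M x hx
    refine (hnorm _ _).2 fun g => ?_
    have h1 : ev g (P M x) = ev ⟨_, htrunc g.1 g.2 M⟩ x := by
      rw [hval x hx, hP, map_sum]
      simp only [map_smul, he, smul_eq_mul]
      rw [pair_eq_sum (T := g.1.support ∪ Finset.range M)]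
      · rw [← Finset.sum_subset (Finset.subset_union_right (s₁ := g.1.support))]
        · refine Finset.sum_congr rfl fun n hn => ?_
          rw [Finsupp.filter_apply_pos (· < M) _ (Finset.mem_range.1 hn), mul_comm]
        · intro n _ hn
          rw [Finsupp.filter_apply_neg (· < M) _ (by simpa using hn), zero_mul]
      · refine fun n hn => Finset.mem_union_left _ ?_
        rw [Finsupp.support_filter] at hn
        exact (Finset.mem_filter.1 hn).1
    rw [h1]
    exact (hnorm _ _).1 le_rfl _
  have hPS : ∀ x ∈ S, ∀ᶠ M in Filter.atTop, P M x = x := by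
    intro x hx
    induction hx using Submodule.span_induction with
    | mem x hx =>
      obtain ⟨n, rfl⟩ := hx
      filter_upwards [Filter.eventually_gt_atTop n] with M hM
      rw [hP, Finset.sum_eq_single n]
      · simp [hce]
      · intro k _ hk
        simp [hce, hk]
      · intro h
        exact absurd (Finset.mem_range.2 hM) h
    | zero => simp
    | add x y _ _ hx hy =>
      filter_upwards [hx, hy] with M h1 h2
      rw [map_add, h1, h2]
    | smul a x _ hx =>
      filter_upwards [hx] with M h1
      rw [map_smul, h1]
  have hPlim : ∀ x ∈ X, Filter.Tendsto (fun M => P M x) Filter.atTop (nhds x) := by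
    intro x hx
    rw [Metric.tendsto_nhds]
    intro r hr
    obtain ⟨y, hy, hxy⟩ := Metric.mem_closure_iff.1 hx (r / 2) (by positivity)
    filter_upwards [hPS y hy] with M hM
    have h1 : P M x - x = P M (x - y) + (y - x) := by rw [map_sub, hM]; abel
    rw [dist_eq_norm, h1]
    have h2 := hPX M (x - y) (X.sub_mem hx (hSX hy))
    have h3 := norm_add_le (P M (x - y)) (y - x)
    rw [dist_eq_norm] at hxy
    rw [norm_sub_rev y x] at h3
    linarith
  have hclosed : IsClosed (X : Set E) := S.isClosed_topologicalClosure
  refine ⟨X, inferInstance, inferInstance, hclosed.completeSpace_coe,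
    { basis := fun n => ⟨e n, heX n⟩
      coord := fun n => (c n).comp X.subtypeL
      ortho := fun i j => ?_
      expansion := fun x => ?_ }, fun x r => ?_⟩
  · simp [hce, Pi.single_apply]
  · rw [HasSum, SummationFilter.conditional_filter_eq_map_range, Filter.tendsto_map'_iff,
      tendsto_subtype_rng]
    refine (hPlim x.1 x.2).congr fun M => ?_
    rw [hP]
    simp
  · change ‖(x : E)‖ ≤ r ↔ ∀ g ∈ F, ‖pair g (fun n => c n x.1)‖ ≤ r
    constructor
    · intro h g hg
      rw [← hval x.1 x.2 ⟨g, hg⟩]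
      exact (hnorm _ _).1 h _
    · intro h
      refine (hnorm _ _).2 fun g => ?_
      rw [hval x.1 x.2 g]
      exact h g.1 g.2

/-- A set of finitely supported functionals that is bounded, contains the coordinate functionals
and is stable under truncation to initial segments is a norming set for a Schauder basis. -/
theorem exists_schauderBasis_of_normingSet {𝕜 : Type u} [RCLike 𝕜] (F : Set (ℕ →₀ 𝕜))
    (hbdd : ∀ g ∈ F, ∀ n, ‖g n‖ ≤ 1) (hcoord : ∀ n, Finsupp.single n 1 ∈ F)
    (htrunc : ∀ g ∈ F, ∀ M, g.filter (· < M) ∈ F) :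
    ∃ (X : Type u) (_ : NormedAddCommGroup X) (_ : NormedSpace 𝕜 X) (_ : CompleteSpace X)
      (b : SchauderBasis 𝕜 X), ∀ (x : X) (r : ℝ),
        ‖x‖ ≤ r ↔ ∀ g ∈ F, ‖pair g (fun n => b.coord n x)‖ ≤ r := by
  have : Nonempty F := ⟨⟨_, hcoord 0⟩⟩
  -- In ℓ_∞(F), let `e n` be the family g ↦ g n and `ev g` the coordinate at g; the sup norm is then
  -- the norm defined by F.
  refine exists_schauderBasis_of_functionals hcoord htrunc (E := lp (fun _ : F => 𝕜) ⊤)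
    (fun n => ⟨fun g => g.1 n, memℓp_infty ⟨1, by rintro _ ⟨g, rfl⟩; exact hbdd g.1 g.2 n⟩⟩)
    (fun g => LinearMap.mkContinuous
      { toFun := fun x => x g, map_add' := fun x y => rfl, map_smul' := fun c x => rfl } 1
      (fun x => by rw [one_mul]; exact lp.norm_apply_le_norm ENNReal.top_ne_zero x g))
    (fun g n => rfl) fun x r => ⟨fun h g => ?_, fun h => ?_⟩
  · exact (lp.norm_apply_le_norm ENNReal.top_ne_zero x g).trans h
  · exact lp.norm_le_of_forall_le' r h

/-! ### A criterion for 1-almost greediness -/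

section AlmostGreedy

variable {𝕜 : Type*} [RCLike 𝕜] {X : Type*} [NormedAddCommGroup X] [NormedSpace 𝕜 X]

lemma coord_basis (b : SchauderBasis 𝕜 X) (i j : ℕ) :
    b.coord i (b j) = if i = j then 1 else 0 := by
  by_cases h : i = j <;> simp [b.ortho, h]

lemma coord_sum (b : SchauderBasis 𝕜 X) (A : Finset ℕ) (u : ℕ → 𝕜) (k : ℕ) :
    b.coord k (∑ n ∈ A, u n • b n) = if k ∈ A then u k else 0 := by
  simp [coord_basis]

lemma coord_coordProj (b : SchauderBasis 𝕜 X) (A : Finset ℕ) (x : X) (k : ℕ) :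
    b.coord k (coordProj b A x) = if k ∈ A then b.coord k x else 0 :=
  coord_sum b A (fun n => b.coord n x) k

lemma coordProj_erase_sub (b : SchauderBasis 𝕜 X) {A : Finset ℕ} {j : ℕ} (hj : j ∈ A) {i : ℕ}
    (hi : i ∉ A.erase j) (x : X) (a : 𝕜) :
    coordProj b (A.erase j) (x - a • b i) = coordProj b A x - b.coord j x • b j := by
  have h : coordProj b (A.erase j) (x - a • b i) = coordProj b (A.erase j) x := by
    refine Finset.sum_congr rfl fun n hn => ?_
    have hni : n ≠ i := fun h => hi (h ▸ hn)
    simp [coord_basis, hni]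
  rw [h, coordProj, coordProj, ← Finset.sum_erase_add A _ hj, add_sub_cancel_right]

/-- A basis is `1`-almost greedy as soon as the norm does not increase when one coefficient of
maximal modulus is deleted, or is moved to a free place and made smaller. -/
theorem isAlmostGreedyBasis_one_of_move (b : SchauderBasis 𝕜 X)
    (hdrop : ∀ (z : X) (i : ℕ) (t : 𝕜), b.coord i z = 0 → (∀ n, ‖b.coord n z‖ ≤ ‖t‖) →
      ‖z‖ ≤ ‖z + t • b i‖)
    (hmove : ∀ (z : X) (i j : ℕ) (s t : 𝕜), j ≠ i → b.coord i z = 0 → b.coord j z = 0 →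
      (∀ n, ‖b.coord n z‖ ≤ ‖t‖) → ‖s‖ ≤ ‖t‖ → ‖z + s • b j‖ ≤ ‖z + t • b i‖) :
    IsAlmostGreedyBasis 1 b := by
  have key : ∀ (m : ℕ) (x : X) (A B : Finset ℕ), A.card = m → IsGreedySet b x A → B.card ≤ m →
      ‖x - coordProj b A x‖ ≤ ‖x - coordProj b B x‖ := by
    intro m
    induction m with
    | zero =>
      intro x A B hA _ hB
      rw [Finset.card_eq_zero.1 hA, Finset.card_eq_zero.1 (Nat.le_zero.1 hB)]
    | succ m ih =>
      intro x A B hA hgr hB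
      have hne : A.Nonempty := Finset.card_pos.1 (by omega)
      -- By greediness a largest coefficient on A is largest overall. Removing it from x and A keeps
      -- the greedy remainder, and the induction hypothesis applies to the rest.
      obtain ⟨i, hiA, himax⟩ := A.exists_max_image (fun n => ‖b.coord n x‖) hne
      have hi : ∀ n, ‖b.coord n x‖ ≤ ‖b.coord i x‖ := fun n =>
        if hn : n ∈ A then himax n hn else hgr i hiA n hn
      let x' := x - b.coord i x • b i
      have hx' : ∀ n, b.coord n x' = if n = i then 0 else b.coord n x := by
        intro n
        by_cases h : n = i <;> simp [x', coord_basis, h]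
      have hA' : (A.erase i).card = m := by rw [Finset.card_erase_of_mem hiA, hA]; rfl
      have hgr' : IsGreedySet b x' (A.erase i) := by
        intro n hn k hk
        obtain ⟨hni, hnA⟩ := Finset.mem_erase.1 hn
        rw [hx', hx', if_neg hni]
        split_ifs with h
        · simp
        · exact hgr n hnA k fun hkA => hk (Finset.mem_erase.2 ⟨h, hkA⟩)
      have hL : x' - coordProj b (A.erase i) x' = x - coordProj b A x := by
        rw [coordProj_erase_sub b hiA (Finset.notMem_erase i A)]
        simp only [x']
        abel
      rw [← hL]
      by_cases hiB : i ∈ B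
      · refine (ih x' _ (B.erase i) hA' hgr' ?_).trans_eq ?_
        · rw [Finset.card_erase_of_mem hiB]; omega
        · rw [coordProj_erase_sub b hiB (Finset.notMem_erase i B)]
          simp only [x']
          congr 1
          abel
      let z := x' - coordProj b B x
      have hz : ∀ n, b.coord n z = if n = i ∨ n ∈ B then 0 else b.coord n x := by
        intro n
        rw [map_sub, hx', coord_coordProj]
        by_cases h1 : n = i
        · simp [h1, hiB]
        · by_cases h2 : n ∈ B <;> simp [h1, h2]
      have hzle : ∀ n, ‖b.coord n z‖ ≤ ‖b.coord i x‖ := by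
        intro n
        rw [hz]
        split_ifs
        · simp
        · exact hi n
      have hxz : x - coordProj b B x = z + b.coord i x • b i := by
        simp only [z, x']
        abel
      rw [hxz]
      -- For i outside B, the induction hypothesis needs one element fewer in B. Freeing some j in B
      -- restores the coefficient at j, so the coefficient at i is traded for it; if B is empty, the
      -- coefficient at i is simply dropped.
      obtain rfl | ⟨j, hj⟩ := B.eq_empty_or_nonempty
      · refine (ih x' _ ∅ hA' hgr' (by simp)).trans ?_
        have : x' - coordProj b ∅ x' = z := by simp [z, coordProj]
        rw [this]
        exact hdrop z i _ (by simp [hz]) hzle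
      · have hji : j ≠ i := fun h => hiB (h ▸ hj)
        refine (ih x' _ (B.erase j) hA' hgr' ?_).trans ?_
        · rw [Finset.card_erase_of_mem hj]; omega
        have : x' - coordProj b (B.erase j) x' = z + b.coord j x • b j := by
          rw [coordProj_erase_sub b hj fun h => hiB (Finset.mem_of_mem_erase h)]
          simp only [z, x']
          abel
        rw [this]
        exact hmove z i j _ _ hji (by simp [hz]) (by simp [hz, hj]) hzle (hi j)
  intro x m A hA hgr
  rw [one_mul, bestProjError]
  refine le_csInf ⟨_, ∅, by simp, rfl⟩ ?_
  rintro _ ⟨B, hB, rfl⟩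
  exact key m x A B hA hgr hB

end AlmostGreedy

/-! ### The weights 1/√m -/

/-- The weight `1 / √m`. -/
noncomputable def wt (m : ℕ) : ℝ := (√(m : ℝ))⁻¹

lemma wt_nonneg (m : ℕ) : 0 ≤ wt m := inv_nonneg.2 (Real.sqrt_nonneg _)

lemma wt_one : wt 1 = 1 := by simp [wt]

lemma wt_anti {m n : ℕ} (hm : 1 ≤ m) (h : m ≤ n) : wt n ≤ wt m := by
  have h1 : (1 : ℝ) ≤ m := by exact_mod_cast hm
  have h2 : (m : ℝ) ≤ n := by exact_mod_cast h
  exact inv_anti₀ (Real.sqrt_pos.2 (by linarith)) (Real.sqrt_le_sqrt h2)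

lemma wt_le_one {m : ℕ} (hm : 1 ≤ m) : wt m ≤ 1 := (wt_anti le_rfl hm).trans_eq wt_one

lemma wt_mul_self {m : ℕ} : wt m * wt m = 1 / m := by
  rw [wt, ← mul_inv, Real.mul_self_sqrt (Nat.cast_nonneg m), one_div]

lemma nat_mul_wt (m : ℕ) : m * wt m = √(m : ℝ) := by
  rw [wt, ← div_eq_mul_inv, Real.div_sqrt]

/-- This is the inequality that fixes the factor 1/4 in `fn`. With a = √m and b = √(m+1) it reads b
+ 5a²(b - a) ≤ 4a, which follows from b - a ≤ 1/(2a) and b ≤ 3a/2. -/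
lemma wt_step {m : ℕ} (hm : 1 ≤ m) :
    wt m / 4 + 5 / 4 * (m * (wt m - wt (m + 1))) ≤ wt (m + 1) := by
  have h1 : (1 : ℝ) ≤ m := by exact_mod_cast hm
  set a := √(m : ℝ) with ha
  set b := √((m : ℝ) + 1) with hb
  have ha2 : a ^ 2 = m := Real.sq_sqrt (by linarith)
  have hb2 : b ^ 2 = m + 1 := Real.sq_sqrt (by linarith)
  have ha0 : 0 < a := Real.sqrt_pos.2 (by linarith)
  have hb0 : 0 < b := Real.sqrt_pos.2 (by linarith)
  have hwa : wt m = a⁻¹ := rfl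
  have hwb : wt (m + 1) = b⁻¹ := by rw [wt, hb]; push_cast; rfl
  rw [hwa, hwb, ← ha2]
  have hab : a < b := Real.sqrt_lt_sqrt (by linarith) (by linarith)
  have key : b + 5 * (a ^ 2 * (b - a)) ≤ 4 * a := by
    have h2 : (b - a) * (b + a) = 1 := by nlinarith
    have h3 : (b - a) * (2 * a) ≤ 1 := by nlinarith
    have h4 : 1 ≤ a := by nlinarith
    have h5 : b - a ≤ a / 2 := by nlinarith
    nlinarith
  have h6 : a⁻¹ / 4 + 5 / 4 * (a ^ 2 * (a⁻¹ - b⁻¹))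
      = (b + 5 * (a ^ 2 * (b - a))) * (a⁻¹ * b⁻¹ / 4) := by
    field_simp
  have h7 : b⁻¹ = 4 * a * (a⁻¹ * b⁻¹ / 4) := by field_simp
  refine h6.trans_le (le_of_le_of_eq ?_ h7.symm)
  exact mul_le_mul_of_nonneg_right key (by positivity)

/-! ### The norming functionals and the move estimates -/

section Functionals

variable {𝕜 : Type*} [RCLike 𝕜]

/-- The functional with coefficients `ε n / √m` on `A`, and coefficients
`min (1 / √m) (1 / √(n + 1)) / 4` at the `n < N` that do not belong to `A`. -/
noncomputable def fn (m : ℕ) (A : Finset ℕ) (N : ℕ) (ε : ℕ → 𝕜) : ℕ →₀ 𝕜 :=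
  Finsupp.onFinset (A ∪ Finset.range N)
    (fun n => if n ∈ A then ε n * (wt m : 𝕜) else
      if n < N then ((wt (max (n + 1) m) / 4 : ℝ) : 𝕜) else 0)
    (fun n hn => by
      by_contra h
      simp only [Finset.mem_union, Finset.mem_range, not_or] at h
      simp [h.1, h.2] at hn)

lemma fn_apply (m : ℕ) (A : Finset ℕ) (N : ℕ) (ε : ℕ → 𝕜) (n : ℕ) :
    fn m A N ε n = if n ∈ A then ε n * (wt m : 𝕜) else
      if n < N then ((wt (max (n + 1) m) / 4 : ℝ) : 𝕜) else 0 := rfl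

lemma support_fn_subset (m : ℕ) (A : Finset ℕ) (N : ℕ) (ε : ℕ → 𝕜) :
    (fn m A N ε).support ⊆ A ∪ Finset.range N := Finsupp.support_onFinset_subset

variable (𝕜) in
/-- The functionals `fn m A N ε` with `A` of at most `m ≥ 1` elements and `ε` of modulus at
most one. -/
def fnSet : Set (ℕ →₀ 𝕜) :=
  {g | ∃ (m : ℕ) (A : Finset ℕ) (N : ℕ) (ε : ℕ → 𝕜),
    1 ≤ m ∧ A.card ≤ m ∧ (∀ n, ‖ε n‖ ≤ 1) ∧ g = fn m A N ε}

lemma norm_fn_apply_of_notMem {m : ℕ} (hm : 1 ≤ m) {A : Finset ℕ} (N : ℕ) (ε : ℕ → 𝕜) {n : ℕ}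
    (hn : n ∉ A) : ‖fn m A N ε n‖ ≤ wt m / 4 := by
  have h0 := wt_nonneg m
  rw [fn_apply, if_neg hn]
  split_ifs
  · have := wt_anti hm (le_max_right (n + 1) m)
    have h1 := wt_nonneg (max (n + 1) m)
    rw [RCLike.norm_ofReal, abs_of_nonneg (by positivity)]
    linarith
  · simpa using by positivity

lemma norm_fn_apply_le {m : ℕ} (hm : 1 ≤ m) (A : Finset ℕ) (N : ℕ) {ε : ℕ → 𝕜}
    (hε : ∀ n, ‖ε n‖ ≤ 1) (n : ℕ) : ‖fn m A N ε n‖ ≤ wt m := by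
  have h0 := wt_nonneg m
  by_cases hn : n ∈ A
  · rw [fn_apply, if_pos hn, norm_mul, RCLike.norm_ofReal, abs_of_nonneg h0]
    exact mul_le_of_le_one_left h0 (hε n)
  · exact (norm_fn_apply_of_notMem hm N ε hn).trans (by linarith)

lemma norm_apply_le_one_of_mem_fnSet {g : ℕ →₀ 𝕜} (hg : g ∈ fnSet 𝕜) (n : ℕ) : ‖g n‖ ≤ 1 := by
  obtain ⟨m, A, N, ε, hm, -, hε, rfl⟩ := hg
  exact (norm_fn_apply_le hm A N hε n).trans (wt_le_one hm)

lemma single_mem_fnSet (n : ℕ) : Finsupp.single n 1 ∈ fnSet 𝕜 := by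
  refine ⟨1, {n}, 0, fun _ => 1, le_rfl, by simp, by simp, ?_⟩
  ext k
  by_cases h : n = k
  · simp [fn_apply, h, wt_one]
  · simp [fn_apply, Ne.symm h]

/-- Truncation may shrink A while m stays the same, which is why `fnSet` asks only for at most m
elements. -/
lemma filter_lt_mem_fnSet {g : ℕ →₀ 𝕜} (hg : g ∈ fnSet 𝕜) (M : ℕ) :
    g.filter (· < M) ∈ fnSet 𝕜 := by
  obtain ⟨m, A, N, ε, hm, hA, hε, rfl⟩ := hg
  refine ⟨m, A.filter (· < M), min N M, ε, hm, (Finset.card_filter_le _ _).trans hA, hε, ?_⟩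
  ext k
  by_cases h : k < M <;> simp [fn_apply, h]

lemma exists_norm_add_mul_eq (a b : 𝕜) : ∃ θ : 𝕜, ‖θ‖ ≤ 1 ∧ ‖a + θ * b‖ = ‖a‖ + ‖b‖ := by
  by_cases hb : b = 0
  · exact ⟨0, by simp, by simp [hb]⟩
  by_cases ha : a = 0
  · exact ⟨1, by simp, by simp [ha]⟩
  have ha' : (‖a‖ : 𝕜) ≠ 0 := by exact_mod_cast norm_ne_zero_iff.2 ha
  have han := norm_ne_zero_iff.2 ha
  have hbn := norm_ne_zero_iff.2 hb
  refine ⟨a * (‖a‖ : 𝕜)⁻¹ * ((‖b‖ : 𝕜) * b⁻¹), ?_, ?_⟩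
  · simp only [norm_mul, norm_inv, RCLike.norm_ofReal, abs_norm]
    field_simp
    rfl
  · have : a + a * (‖a‖ : 𝕜)⁻¹ * ((‖b‖ : 𝕜) * b⁻¹) * b
        = a * (‖a‖ : 𝕜)⁻¹ * ((‖a‖ + ‖b‖ : ℝ) : 𝕜) := by
      push_cast
      field_simp
    rw [this, norm_mul, norm_mul, norm_inv, RCLike.norm_ofReal, RCLike.norm_ofReal, abs_norm,
      abs_of_nonneg (by positivity)]
    field_simp

/-- Since z vanishes at k, the value of ε there is free and can be chosen to align the phase of the
new term with the rest. -/
lemma exists_update_norm_pair (m : ℕ) {A : Finset ℕ} (N : ℕ) {ε : ℕ → 𝕜} {k : ℕ} (hk : k ∈ A)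
    (hε : ∀ n, ‖ε n‖ ≤ 1) {z : ℕ → 𝕜} (hz : z k = 0) (b : 𝕜) :
    ∃ ε' : ℕ → 𝕜, (∀ n, ‖ε' n‖ ≤ 1) ∧
      ‖pair (fn m A N ε') (z + Pi.single k b)‖ = ‖pair (fn m A N ε) z‖ + wt m * ‖b‖ := by
  obtain ⟨θ, hθ, h⟩ := exists_norm_add_mul_eq (pair (fn m A N ε) z) ((wt m : 𝕜) * b)
  refine ⟨Function.update ε k θ, fun n => ?_, ?_⟩
  · by_cases hn : n = k <;> simp [hn, hθ, hε]
  · have h1 : pair (fn m A N (Function.update ε k θ)) z = pair (fn m A N ε) z := by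
      refine pair_congr fun n => ?_
      by_cases hn : n = k
      · simp [hn, hz]
      · simp [fn_apply, hn]
    rw [pair_add_single, h1, fn_apply, if_pos hk, Function.update_self, mul_assoc, h, norm_mul,
      RCLike.norm_ofReal, abs_of_nonneg (wt_nonneg m)]

/-- Passing from m to m + 1 changes the rigid coefficients only at n < m, since from n = m on the
minimum is already 1/√(n+1). The place k is harmless because z vanishes there. -/
lemma norm_fn_sub_fn_insert_mul_le {m : ℕ} (hm : 1 ≤ m) (A : Finset ℕ) (N : ℕ) {ε : ℕ → 𝕜}
    (hε : ∀ n, ‖ε n‖ ≤ 1) {z : ℕ → 𝕜} {k : ℕ} (hz : z k = 0) {r : ℝ} (hr : ∀ n, ‖z n‖ ≤ r)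
    (n : ℕ) :
    ‖fn m A N ε n * z n - fn (m + 1) (insert k A) N ε n * z n‖ ≤
      (if n ∈ A then (wt m - wt (m + 1)) * r else 0) +
        (if n ∈ Finset.range m then (wt m - wt (m + 1)) / 4 * r else 0) := by
  have hr0 : 0 ≤ r := (norm_nonneg _).trans (hr 0)
  have hd : 0 ≤ wt m - wt (m + 1) := sub_nonneg.2 (wt_anti hm (Nat.le_succ m))
  have h1 : 0 ≤ (if n ∈ A then (wt m - wt (m + 1)) * r else 0) := by split_ifs <;> positivity
  have h2 : 0 ≤ (if n ∈ Finset.range m then (wt m - wt (m + 1)) / 4 * r else 0) := by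
    split_ifs <;> positivity
  by_cases hk : n = k
  · rw [hk] at h1 h2 ⊢
    simpa [hz] using add_nonneg h1 h2
  rw [← sub_mul, norm_mul]
  by_cases hA : n ∈ A
  · refine le_trans ?_ (le_add_of_nonneg_right h2)
    have h3 : fn m A N ε n - fn (m + 1) (insert k A) N ε n
        = ε n * ((wt m - wt (m + 1) : ℝ) : 𝕜) := by
      simp [fn_apply, hA, mul_sub]
    rw [if_pos hA, h3, norm_mul, RCLike.norm_ofReal, abs_of_nonneg hd]
    exact mul_le_mul (mul_le_of_le_one_left hd (hε n)) (hr n) (norm_nonneg _) hd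
  · rw [if_neg hA, zero_add]
    have hA' : n ∉ insert k A := by simp [hk, hA]
    simp only [fn_apply, hA, hA', if_false, Finset.mem_range]
    by_cases hN : n < N
    · simp only [hN, if_true]
      by_cases hnm : n < m
      · rw [if_pos hnm, max_eq_right (by omega), max_eq_right (by omega), ← RCLike.ofReal_sub,
          ← sub_div, RCLike.norm_ofReal, abs_of_nonneg (by positivity)]
        exact mul_le_mul_of_nonneg_left (hr n) (by positivity)
      · rw [max_eq_left (by omega), max_eq_left (by omega)]
        simp [hnm]
    · simpa [hN] using h2

/-- The new place contributes `wt (m + 1) * ‖b‖`. The loss comes from at most m places of A at full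
weight and m places n < m at a quarter, hence the 5/4; `wt_step` compares the two. -/
lemma exists_mem_fnSet_gain {m : ℕ} (hm : 1 ≤ m) {A : Finset ℕ} (hA : A.card ≤ m) (N : ℕ)
    {ε : ℕ → 𝕜} (hε : ∀ n, ‖ε n‖ ≤ 1) {z : ℕ → 𝕜} {k : ℕ} (hz : z k = 0) {b : 𝕜}
    (hb : ∀ n, ‖z n‖ ≤ ‖b‖) :
    ∃ g ∈ fnSet 𝕜,
      ‖pair (fn m A N ε) z‖ + wt m / 4 * ‖b‖ ≤ ‖pair g (z + Pi.single k b)‖ := by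
  obtain ⟨ε', hε', h⟩ := exists_update_norm_pair (m + 1) N (Finset.mem_insert_self k A) hε hz b
  refine ⟨_, ⟨m + 1, insert k A, N, ε', by omega,
    (Finset.card_insert_le _ _).trans (by omega), hε', rfl⟩, ?_⟩
  rw [h]
  have hd : 0 ≤ wt m - wt (m + 1) := sub_nonneg.2 (wt_anti hm (Nat.le_succ m))
  have hloss : ‖pair (fn m A N ε) z - pair (fn (m + 1) (insert k A) N ε) z‖
      ≤ 5 / 4 * (m * (wt m - wt (m + 1))) * ‖b‖ := by
    let T := insert k A ∪ Finset.range N ∪ Finset.range m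
    have hAT : A ⊆ T := fun n hn => by simp [T, hn]
    have hmT : Finset.range m ⊆ T := Finset.subset_union_right
    rw [pair_eq_sum _ _ (T := T), pair_eq_sum _ _ (T := T), ← Finset.sum_sub_distrib]
    · refine (norm_sum_le _ _).trans ((Finset.sum_le_sum fun n _ =>
        norm_fn_sub_fn_insert_mul_le hm A N hε hz hb n).trans ?_)
      rw [Finset.sum_add_distrib, Finset.sum_ite_mem, Finset.sum_ite_mem,
        Finset.inter_eq_right.2 hAT, Finset.inter_eq_right.2 hmT, Finset.sum_const,
        Finset.sum_const, Finset.card_range, nsmul_eq_mul, nsmul_eq_mul]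
      have h1 : (A.card : ℝ) * ((wt m - wt (m + 1)) * ‖b‖) ≤ m * ((wt m - wt (m + 1)) * ‖b‖) :=
        mul_le_mul_of_nonneg_right (by exact_mod_cast hA) (by positivity)
      linarith
    · exact (support_fn_subset _ _ _ _).trans Finset.subset_union_left
    · refine (support_fn_subset _ _ _ _).trans fun n hn => ?_
      simp only [T, Finset.mem_union, Finset.mem_insert] at hn ⊢
      tauto
  have h1 := norm_le_norm_add_norm_sub' (pair (fn m A N ε) z)
    (pair (fn (m + 1) (insert k A) N ε) z)
  have h2 := mul_le_mul_of_nonneg_right (wt_step hm) (norm_nonneg b)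
  linarith

lemma exists_mem_fnSet_drop {g : ℕ →₀ 𝕜} (hg : g ∈ fnSet 𝕜) {z : ℕ → 𝕜} {k : ℕ} (hz : z k = 0)
    {b : 𝕜} (hb : ∀ n, ‖z n‖ ≤ ‖b‖) :
    ∃ g' ∈ fnSet 𝕜, ‖pair g z‖ ≤ ‖pair g' (z + Pi.single k b)‖ := by
  obtain ⟨m, A, N, ε, hm, hA, hε, rfl⟩ := hg
  obtain ⟨g', hg', h⟩ := exists_mem_fnSet_gain hm hA N hε hz hb
  have := mul_nonneg (wt_nonneg m) (norm_nonneg b)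
  exact ⟨g', hg', by linarith⟩

lemma exists_mem_fnSet_move {g : ℕ →₀ 𝕜} (hg : g ∈ fnSet 𝕜) {z : ℕ → 𝕜} {j k : ℕ}
    (hzk : z k = 0) (hzj : z j = 0) {a b : 𝕜} (hab : ‖a‖ ≤ ‖b‖) (hb : ∀ n, ‖z n‖ ≤ ‖b‖) :
    ∃ g' ∈ fnSet 𝕜, ‖pair g (z + Pi.single j a)‖ ≤ ‖pair g' (z + Pi.single k b)‖ := by
  obtain ⟨m, A, N, ε, hm, hA, hε, rfl⟩ := hg
  rw [pair_add_single]
  have hadd := norm_add_le (pair (fn m A N ε) z) (fn m A N ε j * a)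
  rw [norm_mul] at hadd
  -- If j is in A, the place k takes over its slot with the same m. Otherwise the coefficient at j
  -- is at most `wt m / 4`, which the gain from enlarging A covers.
  by_cases hj : j ∈ A
  · obtain ⟨ε', hε', h⟩ := exists_update_norm_pair m N
      (Finset.mem_insert_self k (A.erase j)) hε hzk b
    refine ⟨_, ⟨m, insert k (A.erase j), N, ε', hm, ?_, hε', rfl⟩, ?_⟩
    · refine (Finset.card_insert_le _ _).trans ?_
      rwa [Finset.card_erase_add_one hj]
    · have h1 : pair (fn m (insert k (A.erase j)) N ε) z = pair (fn m A N ε) z := by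
        refine pair_congr fun n => ?_
        by_cases hnk : n = k
        · simp [hnk, hzk]
        by_cases hnj : n = j
        · simp [hnj, hzj]
        simp [fn_apply, hnk, hnj]
      rw [h, h1]
      have h2 : ‖fn m A N ε j‖ * ‖a‖ ≤ wt m * ‖b‖ :=
        mul_le_mul (norm_fn_apply_le hm A N hε j) hab (norm_nonneg _) (wt_nonneg m)
      linarith
  · obtain ⟨g', hg', h⟩ := exists_mem_fnSet_gain hm hA N hε hzk hb
    refine ⟨g', hg', ?_⟩
    have h2 : ‖fn m A N ε j‖ * ‖a‖ ≤ wt m / 4 * ‖b‖ :=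
      mul_le_mul (norm_fn_apply_of_notMem hm N ε hj) hab (norm_nonneg _)
        (by linarith [wt_nonneg m])
    linarith

end Functionals

/-! ### Conditionality: the alternating vector and its even part -/

lemma sum_range_wt_le (m : ℕ) : ∑ n ∈ Finset.range m, wt (n + 1) ≤ 2 * √(m : ℝ) := by
  induction m with
  | zero => simp
  | succ m ih =>
    rw [Finset.sum_range_succ]
    set a := √(m : ℝ) with ha
    set b := √((m + 1 : ℕ) : ℝ) with hb
    have hm : (0 : ℝ) ≤ m := Nat.cast_nonneg m
    have ha2 : a ^ 2 = m := Real.sq_sqrt hm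
    have hb2 : b ^ 2 = m + 1 := by rw [hb, Real.sq_sqrt (Nat.cast_nonneg _)]; push_cast; rfl
    have ha0 : 0 ≤ a := Real.sqrt_nonneg _
    have hb0 : 0 < b := Real.sqrt_pos.2 (by positivity)
    have hab : wt (m + 1) ≤ 2 * (b - a) := by
      have : wt (m + 1) = b⁻¹ := rfl
      rw [this, inv_le_iff_one_le_mul₀ hb0]
      nlinarith [sq_nonneg (b - a)]
    linarith

/-- The places below m give at most 2√m, and each of the at most m others gives at most 1/√m. -/
lemma sum_wt_le {m : ℕ} (hm : 1 ≤ m) {A : Finset ℕ} (hA : A.card ≤ m) :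
    ∑ n ∈ A, wt (n + 1) ≤ 3 * √(m : ℝ) := by
  have h : ∀ n ∈ A, wt (n + 1) ≤ (if n ∈ Finset.range m then wt (n + 1) else 0) + wt m := by
    intro n _
    split_ifs with hn
    · linarith [wt_nonneg m]
    · rw [zero_add]
      exact wt_anti hm (by simp at hn; omega)
  refine (Finset.sum_le_sum h).trans ?_
  rw [Finset.sum_add_distrib, Finset.sum_ite_mem, Finset.sum_const, nsmul_eq_mul]
  have h1 : ∑ n ∈ A ∩ Finset.range m, wt (n + 1) ≤ ∑ n ∈ Finset.range m, wt (n + 1) :=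
    Finset.sum_le_sum_of_subset_of_nonneg Finset.inter_subset_right fun n _ _ => wt_nonneg _
  have h2 : (A.card : ℝ) * wt m ≤ m * wt m :=
    mul_le_mul_of_nonneg_right (by exact_mod_cast hA) (wt_nonneg m)
  rw [nat_mul_wt] at h2
  linarith [sum_range_wt_le m]

lemma alternating_sum_mem_Icc (k : ℕ) {a : ℕ → ℝ} (h0 : ∀ n, 0 ≤ a n) (ha : Antitone a) :
    ∑ n ∈ Finset.range k, (-1) ^ n * a n ∈ Set.Icc 0 (a 0) := by
  induction k generalizing a with
  | zero => simpa using h0 0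
  | succ k ih =>
    have h := ih (a := fun n => a (n + 1)) (fun n => h0 _) (fun m n hmn => ha (by omega))
    have h1 : a 1 ≤ a 0 := ha (by omega)
    rw [Finset.sum_range_succ']
    have h2 : ∑ n ∈ Finset.range k, (-1) ^ (n + 1) * a (n + 1)
        = -∑ n ∈ Finset.range k, (-1) ^ n * a (n + 1) := by
      rw [← Finset.sum_neg_distrib]
      exact Finset.sum_congr rfl fun n _ => by ring
    rw [h2]
    simp only [Set.mem_Icc, zero_add] at h ⊢
    constructor <;> linarith [h.1, h.2]

section Conditional

variable {𝕜 : Type*} [RCLike 𝕜]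

/-- Replacing A by the empty set changes each coefficient on A by at most (5/4)/√m, costing at most
(5/4)·3 = 15/4 by `sum_wt_le`. What remains is an alternating sum with decreasing terms, bounded by
its first term, at most 1/4. -/
lemma norm_pair_alternating_le {g : ℕ →₀ 𝕜} (hg : g ∈ fnSet 𝕜) (M : ℕ) :
    ‖pair g (fun n => if n < M then (((-1) ^ n * wt (n + 1) : ℝ) : 𝕜) else 0)‖ ≤ 4 := by
  obtain ⟨m, A, N, ε, hm, hA, hε, rfl⟩ := hg
  set y : ℕ → 𝕜 := fun n => if n < M then (((-1) ^ n * wt (n + 1) : ℝ) : 𝕜) else 0 with hy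
  have hyn : ∀ n, ‖y n‖ ≤ wt (n + 1) := by
    intro n
    simp only [hy]
    split_ifs
    · rw [RCLike.norm_ofReal, abs_mul, abs_pow, abs_neg, abs_one, one_pow, one_mul,
        abs_of_nonneg (wt_nonneg _)]
    · simpa using wt_nonneg _
  let T := A ∪ Finset.range N
  have hsplit : pair (fn m A N ε) y
      = pair (fn m ∅ N ε) y + ∑ n ∈ A, (fn m A N ε n - fn m ∅ N ε n) * y n := by
    rw [pair_eq_sum _ _ (support_fn_subset m A N ε), pair_eq_sum (T := T),
      Finset.sum_subset (s₁ := A) (s₂ := T) Finset.subset_union_left,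
      ← Finset.sum_add_distrib]
    · exact Finset.sum_congr rfl fun n _ => by ring
    · intro n _ hn
      simp [fn_apply, hn]
    · exact (support_fn_subset _ _ _ _).trans (by simp [T])
  have hfirst : ‖∑ n ∈ A, (fn m A N ε n - fn m ∅ N ε n) * y n‖ ≤ 15 / 4 := by
    have h1 : ∀ n ∈ A, ‖(fn m A N ε n - fn m ∅ N ε n) * y n‖ ≤ 5 / 4 * wt m * wt (n + 1) := by
      intro n _
      rw [norm_mul]
      have h2 := norm_sub_le (fn m A N ε n) (fn m ∅ N ε n)
      have h3 := norm_fn_apply_le hm A N hε n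
      have h4 := norm_fn_apply_of_notMem hm N ε (Finset.notMem_empty n)
      exact mul_le_mul (by linarith) (hyn n) (norm_nonneg _) (by linarith [wt_nonneg m])
    refine (norm_sum_le _ _).trans ((Finset.sum_le_sum h1).trans ?_)
    rw [← Finset.mul_sum]
    have h5 := mul_le_mul_of_nonneg_left (sum_wt_le hm hA) (wt_nonneg m)
    have h6 : wt m * √(m : ℝ) = 1 :=
      inv_mul_cancel₀ (Real.sqrt_pos.2 (by exact_mod_cast hm)).ne'
    nlinarith
  have hsecond : ‖pair (fn m ∅ N ε) y‖ ≤ 1 / 4 := by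
    have h1 : pair (fn m ∅ N ε) y = ((∑ n ∈ Finset.range (min N M),
        (-1) ^ n * (wt (max (n + 1) m) / 4 * wt (n + 1)) : ℝ) : 𝕜) := by
      rw [pair_eq_sum _ _ (T := Finset.range N), RCLike.ofReal_sum]
      · rw [← Finset.sum_subset (s₁ := Finset.range (min N M))]
        · refine Finset.sum_congr rfl fun n hn => ?_
          obtain ⟨h2, h3⟩ := lt_min_iff.1 (Finset.mem_range.1 hn)
          simp only [fn_apply, hy, h2, h3, if_true, Finset.notMem_empty, if_false]
          push_cast
          ring
        · simp
        · intro n hn hn'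
          have : ¬ n < M := fun h =>
            hn' (Finset.mem_range.2 (lt_min (Finset.mem_range.1 hn) h))
          simp [hy, this]
      · exact (support_fn_subset _ _ _ _).trans (by simp)
    have h2 := alternating_sum_mem_Icc (min N M)
      (a := fun n => wt (max (n + 1) m) / 4 * wt (n + 1))
      (fun n => mul_nonneg (by linarith [wt_nonneg (max (n + 1) m)]) (wt_nonneg _))
      (fun i j hij => mul_le_mul
        (by linarith [wt_anti (m := max (i + 1) m) (n := max (j + 1) m) (by omega) (by omega)])
        (wt_anti (by omega) (by omega)) (wt_nonneg _) (by linarith [wt_nonneg (max (i + 1) m)]))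
    rw [h1, RCLike.norm_ofReal, abs_of_nonneg h2.1]
    refine h2.2.trans ?_
    have h3 := wt_le_one (m := max (0 + 1) m) (by omega)
    simp only [zero_add, wt_one, mul_one] at h3 ⊢
    linarith
  rw [hsplit]
  refine (norm_add_le _ _).trans ?_
  linarith

lemma sum_le_norm_pair_even (L : ℕ) :
    ∃ g ∈ fnSet 𝕜, (∑ n ∈ Finset.range L, 1 / ((n : ℝ) + 1)) / 8 ≤
      ‖pair g (fun n => if n < 2 * L then ((if Even n then wt (n + 1) else 0 : ℝ) : 𝕜) else 0)‖ := by
  -- With m = 1 and A empty, the coefficients are 1/(4√(n+1)), so each even n contributes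
  -- 1/(4(n+1)).
  refine ⟨_, ⟨1, ∅, 2 * L, 0, le_rfl, by simp, by simp, rfl⟩, ?_⟩
  have h1 : pair (fn 1 ∅ (2 * L) (0 : ℕ → 𝕜))
      (fun n => if n < 2 * L then ((if Even n then wt (n + 1) else 0 : ℝ) : 𝕜) else 0)
      = ((∑ n ∈ Finset.range (2 * L), if Even n then 1 / ((n : ℝ) + 1) / 4 else 0 : ℝ) : 𝕜) := by
    rw [pair_eq_sum _ _ (T := Finset.range (2 * L)), RCLike.ofReal_sum]
    · refine Finset.sum_congr rfl fun n hn => ?_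
      have hmax : max (n + 1) 1 = n + 1 := by omega
      have hsq := wt_mul_self (m := n + 1)
      push_cast at hsq
      simp only [fn_apply, Finset.mem_range.1 hn, if_true, Finset.notMem_empty, if_false, hmax,
        ← hsq]
      rw [← RCLike.ofReal_mul]
      congr 1
      split_ifs <;> ring
    · exact (support_fn_subset _ _ _ _).trans (by simp)
  have h2 : (∑ n ∈ Finset.range L, 1 / ((n : ℝ) + 1)) / 8 ≤
      ∑ n ∈ Finset.range (2 * L), if Even n then 1 / ((n : ℝ) + 1) / 4 else 0 := by
    clear h1
    induction L with
    | zero => simp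
    | succ L ih =>
      rw [Finset.sum_range_succ, Nat.mul_succ, Finset.sum_range_succ, Finset.sum_range_succ,
        if_pos (even_two_mul L), if_neg (by simp)]
      have h3 : 1 / ((L : ℝ) + 1) / 8 ≤ 1 / (((2 * L : ℕ) : ℝ) + 1) / 4 := by
        push_cast
        rw [div_div, div_div]
        exact one_div_le_one_div_of_le (by positivity) (by linarith [Nat.cast_nonneg (α := ℝ) L])
      linarith
  rw [h1, RCLike.norm_ofReal]
  exact h2.trans (le_abs_self _)

end Conditional

/-! ### The basis is almost greedy but not greedy -/

/-- A basis normed by `fnSet` is `1`-almost greedy. -/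
theorem isAlmostGreedyBasis_of_fnSet {𝕜 : Type*} [RCLike 𝕜] {X : Type*} [NormedAddCommGroup X]
    [NormedSpace 𝕜 X] (b : SchauderBasis 𝕜 X)
    (hb : ∀ (x : X) (r : ℝ), ‖x‖ ≤ r ↔ ∀ g ∈ fnSet 𝕜, ‖pair g (fun n => b.coord n x)‖ ≤ r) :
    IsAlmostGreedyBasis 1 b := by
  have hadd : ∀ (z : X) (i : ℕ) (t : 𝕜), (fun n => b.coord n (z + t • b i))
      = (fun n => b.coord n z) + Pi.single i t := by
    intro z i t
    ext n
    by_cases h : n = i <;> simp [coord_basis, h]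
  refine isAlmostGreedyBasis_one_of_move b ?_ ?_
  · intro z i t hi hz
    refine (hb _ _).2 fun g hg => ?_
    obtain ⟨g', hg', h⟩ := exists_mem_fnSet_drop (z := fun n => b.coord n z) hg hi hz
    refine h.trans ?_
    rw [← hadd]
    exact (hb _ _).1 le_rfl g' hg'
  · intro z i j s t _ hi hj hz hst
    refine (hb _ _).2 fun g hg => ?_
    rw [hadd]
    obtain ⟨g', hg', h⟩ := exists_mem_fnSet_move (z := fun n => b.coord n z) hg hi hj hst hz
    refine h.trans ?_
    rw [← hadd]
    exact (hb _ _).1 le_rfl g' hg'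

/-- A basis normed by `fnSet` is not greedy. -/
theorem not_isGreedyBasis_of_fnSet {𝕜 : Type*} [RCLike 𝕜] {X : Type*} [NormedAddCommGroup X]
    [NormedSpace 𝕜 X] (b : SchauderBasis 𝕜 X)
    (hb : ∀ (x : X) (r : ℝ), ‖x‖ ≤ r ↔ ∀ g ∈ fnSet 𝕜, ‖pair g (fun n => b.coord n x)‖ ≤ r)
    {C : ℝ} (hC : 0 ≤ C) : ¬ IsGreedyBasis C b := by
  intro hgreedy
  -- The threshold 32C makes the lower bound, an eighth of the harmonic sum, exceed C times the
  -- upper bound 4.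
  obtain ⟨L, hL⟩ := (Real.tendsto_sum_range_one_div_nat_succ_atTop.eventually_gt_atTop
    (32 * C)).exists
  set M := 2 * L with hM
  let t : ℝ := √(M : ℝ)
  let v : (ℕ → ℝ) → X := fun u => ∑ n ∈ Finset.range M, (u n : 𝕜) • b n
  have hv : ∀ u n, b.coord n (v u) = if n < M then (u n : 𝕜) else 0 := by
    intro u n
    simp only [v]
    rw [coord_sum b _ fun n => (u n : 𝕜)]
    simp
  -- The factor t = √M lifts every odd coefficient to at least 1, hence above all even ones.
  let x := v fun n => if Even n then wt (n + 1) else t * wt (n + 1)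
  let A := (Finset.range M).filter (fun n => ¬ Even n)
  have hAsum : ∀ u : ℕ → ℝ, ∑ n ∈ A, (u n : 𝕜) • b n = v fun n => if Even n then 0 else u n := by
    intro u
    simp only [A, v]
    rw [Finset.sum_filter]
    refine Finset.sum_congr rfl fun n _ => ?_
    by_cases h : Even n <;> simp [h]
  have hsub : ∀ u u' : ℕ → ℝ, v u - v u' = v fun n => u n - u' n := by
    intro u u'
    simp only [v]
    rw [← Finset.sum_sub_distrib]
    refine Finset.sum_congr rfl fun n _ => ?_
    push_cast
    rw [sub_smul]
  have hA : IsGreedySet b x A := by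
    intro n hn k hk
    obtain ⟨hnM, hno⟩ := Finset.mem_filter.1 hn
    rw [Finset.mem_range] at hnM
    have hn1 : ‖b.coord n x‖ = t * wt (n + 1) := by
      rw [hv, if_pos hnM, if_neg hno, RCLike.norm_ofReal,
        abs_of_nonneg (mul_nonneg (Real.sqrt_nonneg _) (wt_nonneg _))]
    have ht : 1 ≤ t * wt (n + 1) := by
      have h1 : t * wt M = 1 := mul_inv_cancel₀
        (Real.sqrt_pos.2 (by exact_mod_cast (Nat.zero_lt_of_lt hnM))).ne'
      rw [← h1]
      exact mul_le_mul_of_nonneg_left (wt_anti (by omega) (by omega)) (Real.sqrt_nonneg _)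
    rw [hn1, hv]
    split_ifs with h1 h2
    · rw [RCLike.norm_ofReal, abs_of_nonneg (wt_nonneg _)]
      exact (wt_le_one (by omega)).trans ht
    · exact absurd (Finset.mem_filter.2 ⟨Finset.mem_range.2 h1, h2⟩) hk
    · rw [norm_zero]; linarith
  have hproj : coordProj b A x = v fun n => if Even n then 0 else t * wt (n + 1) := by
    rw [← hAsum]
    refine Finset.sum_congr rfl fun n hn => ?_
    obtain ⟨hnM, hno⟩ := Finset.mem_filter.1 hn
    rw [hv, if_pos (Finset.mem_range.1 hnM), if_neg hno]
  have hlower : (∑ n ∈ Finset.range L, 1 / ((n : ℝ) + 1)) / 8 ≤ ‖x - coordProj b A x‖ := by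
    obtain ⟨g, hg, h⟩ := sum_le_norm_pair_even (𝕜 := 𝕜) L
    refine h.trans ?_
    have hx : x - coordProj b A x = v fun n => if Even n then wt (n + 1) else 0 := by
      rw [hproj, hsub]
      congr 1
      ext n
      by_cases h : Even n <;> simp [h]
    rw [hx]
    refine le_trans (le_of_eq ?_) ((hb _ _).1 le_rfl g hg)
    simp only [hv, hM]
  have hupper : bestError b A.card x ≤ 4 := by
    -- Subtracting (t + 1)/√(n+1) at odd places turns the coefficient t/√(n+1) into -1/√(n+1),
    -- leaving the alternating vector.
    have hmem : ‖x - ∑ n ∈ A, (((t + 1) * wt (n + 1) : ℝ) : 𝕜) • b n‖ ∈ {r : ℝ | ∃ (B : Finset ℕ)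
        (c : ℕ → 𝕜), B.card ≤ A.card ∧ r = ‖x - ∑ n ∈ B, c n • b n‖} :=
      ⟨A, fun n => (((t + 1) * wt (n + 1) : ℝ) : 𝕜), le_rfl, rfl⟩
    refine (csInf_le ⟨0, ?_⟩ hmem).trans ?_
    · rintro _ ⟨B, c, -, rfl⟩
      exact norm_nonneg _
    · have hx : x - ∑ n ∈ A, (((t + 1) * wt (n + 1) : ℝ) : 𝕜) • b n
          = v fun n => (-1) ^ n * wt (n + 1) := by
        rw [hAsum fun n => (t + 1) * wt (n + 1), hsub]
        congr 1
        ext n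
        by_cases h : Even n
        · simp [h, h.neg_one_pow]
        · simp only [h, if_false, (Nat.not_even_iff_odd.1 h).neg_one_pow]
          ring
      rw [hx, hb]
      intro g hg
      simp only [hv]
      exact norm_pair_alternating_le hg M
  have h := hgreedy x A.card A rfl hA
  have h4 := mul_le_mul_of_nonneg_left hupper hC
  linarith

end TGA

theorem mainTheorem3 (𝕜 : Type u) [RCLike 𝕜] :
    ∃ (X : Type u) (_ : NormedAddCommGroup X) (_ : NormedSpace 𝕜 X) (_ : CompleteSpace X)
      (b : SchauderBasis 𝕜 X),
      TGA.IsAlmostGreedyBasis 1 b ∧ ∀ C : ℝ, 1 ≤ C → ¬ TGA.IsGreedyBasis C b := by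
  obtain ⟨X, i₁, i₂, i₃, b, hb⟩ := TGA.exists_schauderBasis_of_normingSet (TGA.fnSet 𝕜)
    (fun g hg => TGA.norm_apply_le_one_of_mem_fnSet hg) TGA.single_mem_fnSet
    (fun g hg => TGA.filter_lt_mem_fnSet hg)
  exact ⟨X, i₁, i₂, i₃, b, TGA.isAlmostGreedyBasis_of_fnSet b hb,
    fun C hC => TGA.not_isGreedyBasis_of_fnSet b hb (by linarith)⟩
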